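/- Let $0<\alpha<2$ and $c>0$, and let $(X_n)_{n\ge1}$ be real random variables on a probability space $(\Omega,\mathcal F,P)$. Suppose that $(X_n)$ is \emph{determining}: for every event $A$ with $P(A)>0$ there is a (proper) distribution function $F_A$ such that $P(X_n<t\mid A)\to F_A(t)$ as $n\to\infty$ at every continuity point $t$ of $F_A$. Let $\mu$ be its \emph{limit random measure}, that is, a measurable map $\omega\mapsto\mu(\omega)$ into the probability measures on $\mathbb R$ such that for all $t$ in some countable dense set of continuity points of $F_\Omega$ the indicators $I\{X_n\le t\}$ converge weakly in $L^\infty$ to $\mu((-\infty,t])$, i.e. $E(I\{X_n\le t\}\,\eta)\to E(\mu((-\infty,t])\,\eta)$ for every integrable random variable $\eta$. Assume that with probability one $\mu$ belongs to the class $S(\alpha,c)$ of symmetric probability distributions on $\mathbb R$ whose characteristic function $\varphi$ satisfies $$\varphi(t)=1-c|t|^\alpha+o(|t|^\alpha)\qquad (t\to0).$$ Then there is a subsequence $(X_{n_k})$, $n_1<n_2<\cdots$, such that for every real sequence $(a_k)$, not identically zero, satisfying $$\max_{1\le k\le N}|a_k|=o(A_N)\quad(N\to\infty),\qquad A_N=\Big(\sum_{k=1}^N|a_k|^\alpha\Big)^{1/\alpha},$$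 we have $$A_N^{-1}\sum_{k=1}^N a_kX_{n_k}\ \xrightarrow{d}\ G_{\alpha,c}\qquad(N\to\infty),$$ where $G_{\alpha,c}$ is the probability distribution on $\mathbb R$ with characteristic function $\exp(-c|t|^\alpha)$. The same subsequence serves all such $(a_k)$. -/

import Mathlib

open MeasureTheory ProbabilityTheory Filter Topology Asymptotics

noncomputable section

namespace SubseqStable

variable {Ω : Type*} [MeasurableSpace Ω]

/-- `t` is a continuity point of the distribution function `s ↦ ν (-∞, s)`. -/
def IsContPoint (ν : Measure ℝ) (t : ℝ) : Prop :=
  ContinuousAt (fun s : ℝ => ν.real (Set.Iio s)) t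

/-- `ν` is the limit distribution of `(X n)` relative to the event `A`:
`P(X n < t | A) → F_A(t) = ν (-∞, t)` at every continuity point `t` of `F_A`. -/
def IsLimitDistRel (P : Measure Ω) (X : ℕ → Ω → ℝ) (A : Set Ω) (ν : Measure ℝ) : Prop :=
  IsProbabilityMeasure ν ∧
    ∀ t : ℝ, IsContPoint ν t →
      Tendsto (fun n => (P[|A]).real {ω | X n ω < t}) atTop (𝓝 (ν.real (Set.Iio t)))

/-- A sequence of random variables is determining if it has a limit distribution relative to
every event of positive probability. -/
def IsDetermining (P : Measure Ω) (X : ℕ → Ω → ℝ) : Prop :=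
  ∀ A : Set Ω, MeasurableSet A → 0 < P A → ∃ ν : Measure ℝ, IsLimitDistRel P X A ν

/-- Weak convergence in `L^∞` of bounded random variables:
`E(ξ n * η) → E(ξ' * η)` for every integrable `η`. -/
def WeakLinftyTendsto (P : Measure Ω) (ξ : ℕ → Ω → ℝ) (ξ' : Ω → ℝ) : Prop :=
  ∀ η : Ω → ℝ, Integrable η P →
    Tendsto (fun n => ∫ ω, ξ n ω * η ω ∂P) atTop (𝓝 (∫ ω, ξ' ω * η ω ∂P))

/-- The random probability measure `μ` is a limit random measure of `(X n)`: for some countable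
dense set `D` of continuity points of the limit distribution function `F_Ω`, the indicators
`I{X n ≤ t}`, `t ∈ D`, converge weakly in `L^∞` to `G_t = μ (-∞, t]`. -/
def IsLimitRandomMeasure (P : Measure Ω) (X : ℕ → Ω → ℝ) (μ : Kernel Ω ℝ) : Prop :=
  IsMarkovKernel μ ∧
    ∃ ν : Measure ℝ, IsLimitDistRel P X Set.univ ν ∧
      ∃ D : Set ℝ, D.Countable ∧ Dense D ∧ ∀ t ∈ D, IsContPoint ν t ∧
        WeakLinftyTendsto P (fun n => Set.indicator {ω | X n ω ≤ t} 1)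
          (fun ω => (μ ω).real (Set.Iic t))

/-- The class `S(α, c)` of symmetric probability distributions on `ℝ` with characteristic function
`φ(t) = 1 - c |t|^α + o(|t|^α)` as `t → 0`. -/
def stableClass (α c : ℝ) : Set (Measure ℝ) :=
  {ν | IsProbabilityMeasure ν ∧ ν.map (fun x => -x) = ν ∧
    (fun t : ℝ => charFun ν t - ((1 - c * |t| ^ α : ℝ) : ℂ)) =o[𝓝 0] (fun t : ℝ => |t| ^ α)}

/-- `A_N = (∑ |a_k|^α)^{1/α}`, the sum running over the first `N` weights. -/
def weightNorm (α : ℝ) (a : ℕ → ℝ) (N : ℕ) : ℝ :=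
  (∑ k ∈ Finset.range N, |a k| ^ α) ^ (1 / α)

/-- The maximum of `|a_k|` over the first `N` weights. -/
def weightMax (a : ℕ → ℝ) (N : ℕ) : ℝ :=
  ((Finset.range N).sup (fun k => ‖a k‖₊) : NNReal)

end SubseqStable

end

/-!
Weak convergence in `L^∞` says that `(W, X_m)` converges in law to a pair whose second entry is
drawn from `μ`, for every `W` defined on `Ω`. Taking `W = (X_{n_1}, …, X_{n_{k-1}})`, one can pick
`n_k` so large that the characteristic functions of the pair are within `2^{-k}` of the limiting
ones, uniformly over frequencies in `[-1, 1]`. Replacing `X_{n_k}` by a draw from `μ` contributes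
the random factor `φ(t_k)`. On an event of probability close to one, `φ(t)` differs from
`exp (-c |t|^α)` by at most `M |t|^α`, so by dominated convergence the expected cost of replacing
`φ(t_k)` by `exp (-c |t_k|^α)` is `o(|t_k|^α)`. Peeling off the factors one by one, the
characteristic function of the weighted sum becomes `∏ exp (-c |t_k|^α) = exp (-c ∑ |t_k|^α)`.
-/

noncomputable section

namespace SubseqStable

section JointConvergence

variable {Ω : Type*} [MeasurableSpace Ω] {P : Measure Ω} {X : ℕ → Ω → ℝ} {μ : Kernel Ω ℝ}

/-- The convergence required of a level `t` in `IsLimitRandomMeasure`. -/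
def WeakLinftyTendstoAt (P : Measure Ω) (X : ℕ → Ω → ℝ) (μ : Kernel Ω ℝ) (t : ℝ) : Prop :=
  WeakLinftyTendsto P (fun n => Set.indicator {ω | X n ω ≤ t} 1)
    (fun ω => (μ ω).real (Set.Iic t))

lemma measureReal_compProd_prod {β : Type*} [MeasurableSpace β] [SFinite P] {κ : Kernel Ω β}
    [IsFiniteKernel κ] {B : Set Ω} {s : Set β} (hB : MeasurableSet B) (hs : MeasurableSet s) :
    (P ⊗ₘ κ).real (B ×ˢ s) = ∫ ω in B, (κ ω).real s ∂P := by
  rw [Measure.real, Measure.compProd_apply_prod hB hs, ← integral_toReal]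
  · rfl
  · exact (κ.measurable_coe hs).aemeasurable
  · exact ae_of_all _ fun ω => measure_lt_top _ _

lemma WeakLinftyTendstoAt.tendsto_measureReal_inter_preimage_Iic [IsFiniteMeasure P]
    [IsMarkovKernel μ] {t : ℝ} (h : WeakLinftyTendstoAt P X μ t)
    (hX : ∀ n, Measurable (X n)) {B : Set Ω} (hB : MeasurableSet B) :
    Tendsto (fun n => P.real (B ∩ X n ⁻¹' Set.Iic t)) atTop
      (𝓝 ((P ⊗ₘ μ).real (B ×ˢ Set.Iic t))) := by
  have hη := h (B.indicator 1) ((integrable_const 1).indicator hB)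
  rw [measureReal_compProd_prod hB measurableSet_Iic, ← integral_indicator hB]
  convert hη using 2 with n
  · rw [← integral_indicator_one (hB.inter (hX n measurableSet_Iic)), Set.inter_comm]
    simp [← Set.inter_indicator_mul, Set.preimage, Pi.one_def]
  · congr 1
    ext ω
    by_cases hω : ω ∈ B <;> simp [hω]

lemma measureReal_inter_preimage_Ioc {S : Type*} [MeasurableSpace S] (Q : Measure S)
    [IsFiniteMeasure Q] {Y : S → ℝ} (hY : Measurable Y) {B : Set S} (hB : MeasurableSet B)
    {a b : ℝ} (hab : a ≤ b) :
    Q.real (B ∩ Y ⁻¹' Set.Ioc a b)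
      = Q.real (B ∩ Y ⁻¹' Set.Iic b) - Q.real (B ∩ Y ⁻¹' Set.Iic a) := by
  have hsub : B ∩ Y ⁻¹' Set.Iic a ⊆ B ∩ Y ⁻¹' Set.Iic b := by gcongr
  rw [← measureReal_sdiff hsub (hB.inter (hY measurableSet_Iic)), ← Set.inter_sdiff_distrib_left,
    ← Set.preimage_sdiff, Set.Iic_sdiff_Iic]

lemma tendsto_measureReal_inter_preimage_Ioc [IsFiniteMeasure P] [IsMarkovKernel μ] {a b : ℝ}
    (hab : a ≤ b) (ha : WeakLinftyTendstoAt P X μ a)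
    (hb : WeakLinftyTendstoAt P X μ b)
    (hX : ∀ n, Measurable (X n)) {B : Set Ω} (hB : MeasurableSet B) :
    Tendsto (fun n => P.real (B ∩ X n ⁻¹' Set.Ioc a b)) atTop
      (𝓝 ((P ⊗ₘ μ).real (B ×ˢ Set.Ioc a b))) := by
  have hlim : (P ⊗ₘ μ).real (B ×ˢ Set.Ioc a b)
      = (P ⊗ₘ μ).real (B ×ˢ Set.Iic b) - (P ⊗ₘ μ).real (B ×ˢ Set.Iic a) :=
    measureReal_inter_preimage_Ioc _ measurable_snd (measurable_fst hB) hab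
  simp_rw [hlim, measureReal_inter_preimage_Ioc P (hX _) hB hab]
  exact (hb.tendsto_measureReal_inter_preimage_Iic hX hB).sub
    (ha.tendsto_measureReal_inter_preimage_Iic hX hB)

variable {E : Type*} [MeasurableSpace E] [TopologicalSpace E] [SecondCountableTopology E]
  [OpensMeasurableSpace E]

lemma tendstoInDistribution_prodMk [IsProbabilityMeasure P] [IsMarkovKernel μ] {D : Set ℝ}
    (hD : Dense D) (h : ∀ t ∈ D, WeakLinftyTendstoAt P X μ t) (hX : ∀ n, Measurable (X n))
    {W : Ω → E} (hW : Measurable W) :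
    TendstoInDistribution (fun n ω => (W ω, X n ω)) atTop (fun z : Ω × ℝ => (W z.1, z.2))
      (fun _ => P) (P ⊗ₘ μ) where
  forall_aemeasurable n := (hW.prodMk (hX n)).aemeasurable
  aemeasurable_limit := by fun_prop
  tendsto := by
    have hpi := (MeasurableSpace.isPiSystem_measurableSet (α := E)).prod (isPiSystem_Ioc_mem D D)
    refine hpi.tendsto_probabilityMeasure_of_tendsto_of_mem ?_ ?_ ?_
    · rintro _ ⟨B, hB, _, ⟨a, -, b, -, -, rfl⟩, rfl⟩
      exact hB.prod measurableSet_Ioc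
    · rintro u hu ⟨w, x⟩ hx
      obtain ⟨V, V', hV, hV', hw, hx, hsub⟩ := isOpen_prod_iff.1 hu w x hx
      obtain ⟨l, r, ⟨hl, hr⟩, hlr⟩ := mem_nhds_iff_exists_Ioo_subset.1 (hV'.mem_nhds hx)
      obtain ⟨a, haD, ha⟩ := hD.exists_between hl
      obtain ⟨b, hbD, hb⟩ := hD.exists_between hr
      refine ⟨V ×ˢ Set.Ioc a b,
        ⟨V, hV.measurableSet, _, ⟨a, haD, b, hbD, ha.2.trans hb.1, rfl⟩, rfl⟩,
        prod_mem_nhds (hV.mem_nhds hw) (Ioc_mem_nhds ha.2 hb.1), ?_⟩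
      exact (Set.prod_mono_right ((Set.Ioc_subset_Ioo ha.1.le hb.2).trans hlr)).trans hsub
    · rintro _ ⟨B, hB, _, ⟨a, haD, b, hbD, hab, rfl⟩, rfl⟩
      rw [← NNReal.tendsto_coe]
      have key := tendsto_measureReal_inter_preimage_Ioc hab.le (h a haD) (h b hbD) hX (hW hB)
      convert key using 2 with n
      · change ((P.map _).real _) = _
        rw [map_measureReal_apply (hW.prodMk (hX n)) (hB.prod measurableSet_Ioc)]
        rfl
      · change ((P ⊗ₘ μ).map _).real _ = _
        rw [map_measureReal_apply (by fun_prop) (hB.prod measurableSet_Ioc)]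
        rfl

end JointConvergence

section UniformConvergence

variable {T E : Type*} [TopologicalSpace T] [SecondCountableTopology T]
  [TopologicalSpace.PseudoMetrizableSpace T] [TopologicalSpace E] [SecondCountableTopology E]
  [TopologicalSpace.PseudoMetrizableSpace E] [MeasurableSpace E] [OpensMeasurableSpace E]

lemma tendsto_integral_of_continuous_uncurry {ι : Type*} {l : Filter ι}
    {Q : ι → ProbabilityMeasure E} {Q' : ProbabilityMeasure E} (hQ : Tendsto Q l (𝓝 Q'))
    {u : ι → T} {t : T} (hu : Tendsto u l (𝓝 t)) {F : T → E → ℂ} (hF : Continuous F.uncurry)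
    {C : ℝ} (hC : ∀ t x, ‖F t x‖ ≤ C) :
    Tendsto (fun i => ∫ x, F (u i) x ∂(Q i : Measure E)) l (𝓝 (∫ x, F t x ∂(Q' : Measure E))) := by
  borelize T
  let f : BoundedContinuousFunction (T × E) ℂ :=
    BoundedContinuousFunction.ofNormedAddCommGroup F.uncurry hF C fun z => hC z.1 z.2
  have hprod := (ProbabilityMeasure.continuous_prod.tendsto (diracProba t, Q')).comp
    (((continuous_diracProba.tendsto t).comp hu).prodMk_nhds hQ)
  have hint (v : T) (R : ProbabilityMeasure E) :
      ∫ z, f z ∂((diracProba v).prod R : Measure (T × E)) = ∫ x, F v x ∂(R : Measure E) := by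
    simp only [ProbabilityMeasure.toMeasure_prod]
    change ∫ z, f z ∂((Measure.dirac v).prod (R : Measure E)) = _
    rw [Measure.dirac_prod, integral_map (by fun_prop) f.continuous.aestronglyMeasurable]
    rfl
  simpa only [Function.comp_apply, hint] using
    (ProbabilityMeasure.tendsto_iff_forall_integral_rclike_tendsto ℂ).1 hprod f

lemma tendstoUniformlyOn_integral {ι Ω Ω' : Type*} {l : Filter ι} [MeasurableSpace Ω]
    [MeasurableSpace Ω'] {P : Measure Ω} [IsProbabilityMeasure P] {P' : Measure Ω'}
    [IsProbabilityMeasure P'] {Y : ι → Ω → E} {Z : Ω' → E}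
    (hYZ : TendstoInDistribution Y l Z (fun _ => P) P') {F : T → E → ℂ}
    (hF : Continuous F.uncurry) {C : ℝ} (hC : ∀ t x, ‖F t x‖ ≤ C) {K : Set T} (hK : IsCompact K) :
    TendstoUniformlyOn (fun i t => ∫ ω, F t (Y i ω) ∂P) (fun t => ∫ ω, F t (Z ω) ∂P') l K := by
  rw [← tendstoLocallyUniformlyOn_iff_tendstoUniformlyOn_of_compact hK,
    tendstoLocallyUniformlyOn_iff_forall_tendsto]
  intro t _
  let law (i : ι) : ProbabilityMeasure E :=
    ⟨P.map (Y i), Measure.isProbabilityMeasure_map (hYZ.forall_aemeasurable i)⟩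
  let law' : ProbabilityMeasure E :=
    ⟨P'.map Z, Measure.isProbabilityMeasure_map hYZ.aemeasurable_limit⟩
  have hmeas (v : T) : StronglyMeasurable (F v) :=
    (hF.comp (Continuous.prodMk_right v)).stronglyMeasurable
  have hlaw (i : ι) (v : T) : ∫ ω, F v (Y i ω) ∂P = ∫ x, F v x ∂(law i : Measure E) :=
    (integral_map (hYZ.forall_aemeasurable i) (hmeas v).aestronglyMeasurable).symm
  have hlaw' (v : T) : ∫ ω, F v (Z ω) ∂P' = ∫ x, F v x ∂(law' : Measure E) :=
    (integral_map hYZ.aemeasurable_limit (hmeas v).aestronglyMeasurable).symm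
  have hsnd : Tendsto Prod.snd (l ×ˢ 𝓝[K] t) (𝓝 t) :=
    tendsto_snd.mono_right nhdsWithin_le_nhds
  simp_rw [hlaw, hlaw']
  exact ((tendsto_integral_of_continuous_uncurry tendsto_const_nhds hsnd hF hC).prodMk_nhds
    (tendsto_integral_of_continuous_uncurry (hYZ.tendsto.comp tendsto_fst) hsnd hF hC)).mono_right
    (nhds_le_uniformity _)

end UniformConvergence

section SubsequenceChoice

/-- The product of `exp (i t_j x_j)` over `j ∈ s`; at `x_j = X_{n_j}` these are the factors of the
characteristic function of a weighted sum. -/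
def expProd (s : Finset ℕ) (t x : ℕ → ℝ) : ℂ := ∏ j ∈ s, Complex.exp (t j * x j * Complex.I)

lemma norm_expProd (s : Finset ℕ) (t x : ℕ → ℝ) : ‖expProd s t x‖ = 1 := by
  simp only [expProd, norm_prod, ← Complex.ofReal_mul, Complex.norm_exp_ofReal_mul_I,
    Finset.prod_const_one]

lemma continuous_expProd (s : Finset ℕ) : Continuous fun z : (ℕ → ℝ) × (ℕ → ℝ) =>
    expProd s z.1 z.2 := by
  unfold expProd
  fun_prop

variable {Ω : Type*} [MeasurableSpace Ω] {P : Measure Ω} {X : ℕ → Ω → ℝ} {μ : Kernel Ω ℝ}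

lemma measurable_expProd (hX : ∀ n, Measurable (X n)) (s : Finset ℕ) (n : ℕ → ℕ) (t : ℕ → ℝ) :
    Measurable fun ω => expProd s t fun j => X (n j) ω := by
  unfold expProd
  fun_prop

lemma measurable_charFun_kernel (t : ℝ) :
    Measurable fun ω => charFun (μ ω) t := by
  simp only [charFun_apply_real]
  refine (StronglyMeasurable.integral_kernel ?_).measurable
  exact Measurable.stronglyMeasurable (by fun_prop)

lemma integral_compProd_mul_exp [IsFiniteMeasure P] [IsMarkovKernel μ] {Y : Ω → ℂ}
    (hY : Integrable Y P) (t : ℝ) :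
    ∫ z, Y z.1 * Complex.exp (t * z.2 * Complex.I) ∂(P ⊗ₘ μ) = ∫ ω, Y ω * charFun (μ ω) t ∂P := by
  have hYfst : Integrable (fun z : Ω × ℝ => Y z.1) (P ⊗ₘ μ) := by
    have := hY
    rw [← Measure.fst_compProd P μ] at this
    exact this.comp_measurable measurable_fst
  rw [Measure.integral_compProd]
  · simp_rw [integral_const_mul, charFun_apply_real]
  · refine hYfst.mul_bdd (c := 1) (by fun_prop) (ae_of_all _ fun z => ?_)
    rw [← Complex.ofReal_mul, Complex.norm_exp_ofReal_mul_I]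

lemma tendstoUniformlyOn_integral_mul_exp {T E : Type*} [TopologicalSpace T]
    [SecondCountableTopology T] [TopologicalSpace.PseudoMetrizableSpace T] [TopologicalSpace E]
    [SecondCountableTopology E] [TopologicalSpace.PseudoMetrizableSpace E] [MeasurableSpace E]
    [OpensMeasurableSpace E] [IsProbabilityMeasure P] [IsMarkovKernel μ] {D : Set ℝ}
    (hD : Dense D) (h : ∀ t ∈ D, WeakLinftyTendstoAt P X μ t) (hX : ∀ n, Measurable (X n))
    {W : Ω → E} (hW : Measurable W) {Y : T → E → ℂ} (hY : Continuous Y.uncurry) {C : ℝ}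
    (hC : ∀ t w, ‖Y t w‖ ≤ C) {u : T → ℝ} (hu : Continuous u) {K : Set T} (hK : IsCompact K) :
    TendstoUniformlyOn (fun m t => ∫ ω, Y t (W ω) * Complex.exp (u t * X m ω * Complex.I) ∂P)
      (fun t => ∫ ω, Y t (W ω) * charFun (μ ω) (u t) ∂P) atTop K := by
  let F (t : T) (z : E × ℝ) : ℂ := Y t z.1 * Complex.exp (u t * z.2 * Complex.I)
  have hF : Continuous F.uncurry :=
    (hY.comp (by fun_prop : Continuous fun p : T × E × ℝ => (p.1, p.2.1))).mul (by fun_prop)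
  have hFC (t : T) (z : E × ℝ) : ‖F t z‖ ≤ C := by
    rw [norm_mul, ← Complex.ofReal_mul, Complex.norm_exp_ofReal_mul_I, mul_one]
    exact hC t z.1
  have hYW (t : T) : Integrable (fun ω => Y t (W ω)) P :=
    Integrable.of_bound ((hY.comp (Continuous.prodMk_right t)).measurable.comp hW
      ).aestronglyMeasurable C (ae_of_all _ fun ω => hC t (W ω))
  simp_rw [← integral_compProd_mul_exp (hYW _)]
  exact tendstoUniformlyOn_integral (tendstoInDistribution_prodMk hD h hX hW) hF hFC hK

lemma eventually_norm_setIntegral_sub_le [IsProbabilityMeasure P] [IsMarkovKernel μ] {D : Set ℝ}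
    (hD : Dense D) (h : ∀ t ∈ D, WeakLinftyTendstoAt P X μ t) (hX : ∀ n, Measurable (X n))
    {A : Set Ω} (hA : MeasurableSet A) (s : Finset ℕ) (n : ℕ → ℕ) (k : ℕ) {ε : ℝ} (hε : 0 < ε) :
    ∀ᶠ m in atTop, ∀ t : ℕ → ℝ, (∀ j, |t j| ≤ 1) →
      ‖(∫ ω in A, expProd s t (fun j => X (n j) ω) * Complex.exp (t k * X m ω * Complex.I) ∂P)
        - ∫ ω in A, expProd s t (fun j => X (n j) ω) * charFun (μ ω) (t k) ∂P‖ ≤ ε := by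
  classical
  -- With the event `A` as a coordinate of `W`, compactness of `[-1, 1]^ℕ` gives uniformity in `t`.
  let W (ω : Ω) : Bool × (ℕ → ℝ) := (decide (ω ∈ A), fun j => X (n j) ω)
  have hW : Measurable W := (measurable_to_bool (by simpa [Set.preimage])).prodMk (by fun_prop)
  let Y (t : ℕ → ℝ) (w : Bool × (ℕ → ℝ)) : ℂ := (if w.1 then 1 else 0) * expProd s t w.2
  have hY : Continuous Y.uncurry :=
    ((continuous_of_discreteTopology (f := fun b : Bool => if b then (1 : ℂ) else 0)).comp
      (by fun_prop)).mul ((continuous_expProd s).comp (by fun_prop :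
        Continuous fun p : (ℕ → ℝ) × Bool × (ℕ → ℝ) => (p.1, p.2.2)))
  have hYle (t : ℕ → ℝ) (w : Bool × (ℕ → ℝ)) : ‖Y t w‖ ≤ 1 := by
    rw [norm_mul, norm_expProd, mul_one]
    split_ifs <;> simp
  have hYW (t : ℕ → ℝ) (g : Ω → ℂ) : ∫ ω, Y t (W ω) * g ω ∂P
      = ∫ ω in A, expProd s t (fun j => X (n j) ω) * g ω ∂P := by
    rw [← integral_indicator hA]
    refine integral_congr_ae (ae_of_all _ fun ω => ?_)
    by_cases hω : ω ∈ A <;> simp [hω, Y, W]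
  have hK : IsCompact (Set.univ.pi fun _ : ℕ => Set.Icc (-1 : ℝ) 1) :=
    isCompact_univ_pi fun _ => isCompact_Icc
  have hunif := tendstoUniformlyOn_integral_mul_exp hD h hX hW hY hYle (continuous_apply k) hK
  filter_upwards [Metric.tendstoUniformlyOn_iff.1 hunif ε hε] with m hm t ht
  have hmt := (hm t fun j _ => abs_le.1 (ht j)).le
  rwa [dist_comm, dist_eq_norm, hYW, hYW] at hmt

/-- Given the previous terms, `X_{n_k}` behaves as if it were drawn from the random measure `μ`, up
to an error `2^{-k}`, on each of the first events `A_M` and for all frequencies in `[-1, 1]`. -/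
def IsAlmostExchangeable (P : Measure Ω) (X : ℕ → Ω → ℝ) (μ : Kernel Ω ℝ) (A : ℕ → Set Ω)
    (n : ℕ → ℕ) : Prop :=
  ∀ k, ∀ M ≤ k, ∀ t : ℕ → ℝ, (∀ j, |t j| ≤ 1) →
    ‖(∫ ω in A M, expProd (Finset.Ico M (k + 1)) t (fun j => X (n j) ω) ∂P)
      - ∫ ω in A M, expProd (Finset.Ico M k) t (fun j => X (n j) ω) * charFun (μ ω) (t k) ∂P‖
      ≤ (1 / 2) ^ k

lemma exists_strictMono_of_eventually {Q : ℕ → (ℕ → ℕ) → ℕ → Prop}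
    (hQ : ∀ k f, ∀ᶠ m in atTop, Q k f m)
    (hcongr : ∀ k f g m, (∀ j < k, f j = g j) → Q k f m → Q k g m) :
    ∃ n : ℕ → ℕ, StrictMono n ∧ ∀ k, Q k n (n k) := by
  have hex (k : ℕ) (f : ℕ → ℕ) : ∃ m, Q k f m ∧ ∀ j < k, f j < m := by
    refine ((hQ k f).and ?_).exists
    exact (Set.finite_lt_nat k).eventually_all.2 fun j _ => eventually_gt_atTop (f j)
  choose F hFQ hFlt using hex
  let step : (k : ℕ) → ((j : ℕ) → j < k → ℕ) → ℕ :=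
    fun k ih => F k fun j => if h : j < k then ih j h else 0
  let n : ℕ → ℕ := Nat.lt_wfRel.wf.fix step
  have hn (k : ℕ) : n k = F k fun j => if j < k then n j else 0 := by
    simpa [step, n] using Nat.lt_wfRel.wf.fix_eq step k
  refine ⟨n, strictMono_nat_of_lt_succ fun k => ?_, fun k => ?_⟩
  · have h := hFlt (k + 1) (fun j => if j < k + 1 then n j else 0) k k.lt_succ_self
    rw [← hn] at h
    simpa using h
  · have h := hFQ k fun j => if j < k then n j else 0
    rw [← hn] at h
    exact hcongr k _ _ _ (fun j hj => by simp [hj]) h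

lemma IsLimitRandomMeasure.exists_isAlmostExchangeable [IsProbabilityMeasure P]
    (hμ : IsLimitRandomMeasure P X μ) (hX : ∀ n, Measurable (X n)) {A : ℕ → Set Ω}
    (hA : ∀ M, MeasurableSet (A M)) :
    ∃ n : ℕ → ℕ, StrictMono n ∧ IsAlmostExchangeable P X μ A n := by
  obtain ⟨_, _, -, D, -, hD, h⟩ := hμ
  let Q (k : ℕ) (n : ℕ → ℕ) (m : ℕ) : Prop := ∀ M ≤ k, ∀ t : ℕ → ℝ, (∀ j, |t j| ≤ 1) →
    ‖(∫ ω in A M, expProd (Finset.Ico M k) t (fun j => X (n j) ω)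
        * Complex.exp (t k * X m ω * Complex.I) ∂P)
      - ∫ ω in A M, expProd (Finset.Ico M k) t (fun j => X (n j) ω) * charFun (μ ω) (t k) ∂P‖
      ≤ (1 / 2) ^ k
  have hQ (k : ℕ) (n : ℕ → ℕ) : ∀ᶠ m in atTop, Q k n m :=
    (Set.finite_le_nat k).eventually_all.2 fun M _ => eventually_norm_setIntegral_sub_le hD
      (fun t ht => (h t ht).2) hX (hA M) _ n k (by positivity)
  have hcongr (k : ℕ) (f g : ℕ → ℕ) (m : ℕ) (hfg : ∀ j < k, f j = g j) (hf : Q k f m) :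
      Q k g m := by
    intro M hM t ht
    have hprod (ω : Ω) : expProd (Finset.Ico M k) t (fun j => X (g j) ω)
        = expProd (Finset.Ico M k) t (fun j => X (f j) ω) :=
      Finset.prod_congr rfl fun j hj => by simp only [hfg j (Finset.mem_Ico.1 hj).2]
    simpa only [hprod] using hf M hM t ht
  obtain ⟨n, hmono, hn⟩ := exists_strictMono_of_eventually hQ hcongr
  refine ⟨n, hmono, fun k M hM t ht => ?_⟩
  simpa only [expProd, Finset.prod_Ico_succ_top hM] using hn k M hM t ht

end SubsequenceChoice

section StableExpansion

/-- The characteristic function `exp (-c |t|^α)` of the symmetric stable law. -/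
def stableCharFun (α c t : ℝ) : ℝ := Real.exp (-c * |t| ^ α)

/-- The expansion `φ(t) = 1 - c |t|^α + o(|t|^α)` at `0` of the characteristic function of `ν`, as
required in `stableClass`. -/
def HasStableExpansion (α c : ℝ) (ν : Measure ℝ) : Prop :=
  (fun t : ℝ => charFun ν t - ((1 - c * |t| ^ α : ℝ) : ℂ)) =o[𝓝 0] (fun t : ℝ => |t| ^ α)

variable {α c : ℝ}

lemma norm_stableCharFun_le_one (hc : 0 ≤ c) (α t : ℝ) : ‖(stableCharFun α c t : ℂ)‖ ≤ 1 := by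
  rw [Complex.norm_real, stableCharFun, Real.norm_of_nonneg (Real.exp_pos _).le,
    Real.exp_le_one_iff]
  exact mul_nonpos_of_nonpos_of_nonneg (neg_nonpos.2 hc) (by positivity)

lemma continuous_abs_rpow (hα : 0 < α) : Continuous fun t : ℝ => |t| ^ α :=
  continuous_abs.rpow_const fun _ => Or.inr hα.le

lemma continuous_stableCharFun (hα : 0 < α) (c : ℝ) : Continuous (stableCharFun α c) :=
  Real.continuous_exp.comp (continuous_const.mul (continuous_abs_rpow hα))

lemma stableCharFun_sub_isLittleO (hα : 0 < α) (c : ℝ) :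
    (fun t : ℝ => stableCharFun α c t - (1 - c * |t| ^ α)) =o[𝓝 0] (fun t : ℝ => |t| ^ α) := by
  have hexp : (fun x : ℝ => Real.exp x - 1 - x) =o[𝓝 0] (fun x : ℝ => x) := by
    simpa using hasDerivAt_iff_isLittleO.1 (Real.hasDerivAt_exp 0)
  have hlim : Tendsto (fun t : ℝ => -c * |t| ^ α) (𝓝 0) (𝓝 0) := by
    simpa [Real.zero_rpow hα.ne'] using ((continuous_abs_rpow hα).tendsto 0).const_mul (-c)
  refine ((hexp.comp_tendsto hlim).trans_isBigO
    (isBigO_const_mul_self (-c) (fun t : ℝ => |t| ^ α) (𝓝 0))).congr_left fun t => ?_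
  simp only [Function.comp_apply, stableCharFun]
  ring

lemma HasStableExpansion.charFun_sub_isLittleO {ν : Measure ℝ} (hν : HasStableExpansion α c ν)
    (hα : 0 < α) :
    (fun t : ℝ => charFun ν t - (stableCharFun α c t : ℂ)) =o[𝓝 0] (fun t : ℝ => |t| ^ α) := by
  have hg : (fun t : ℝ => ((stableCharFun α c t - (1 - c * |t| ^ α) : ℝ) : ℂ)) =o[𝓝 0]
      (fun t : ℝ => |t| ^ α) := by
    refine IsLittleO.of_norm_left ?_
    simpa only [Complex.norm_real] using (stableCharFun_sub_isLittleO hα c).norm_left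
  refine (hν.sub hg).congr_left fun t => ?_
  push_cast
  ring

lemma HasStableExpansion.exists_norm_charFun_sub_le {ν : Measure ℝ} [IsProbabilityMeasure ν]
    (hν : HasStableExpansion α c ν) (hα : 0 < α) (hc : 0 ≤ c) :
    ∃ M : ℕ, ∀ t : ℝ, ‖charFun ν t - (stableCharFun α c t : ℂ)‖ ≤ M * |t| ^ α := by
  obtain ⟨δ, hδ, hball⟩ := Metric.eventually_nhds_iff.1 ((hν.charFun_sub_isLittleO hα).def one_pos)
  obtain ⟨M, hM⟩ := exists_nat_ge (max 1 (2 / δ ^ α))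
  refine ⟨M, fun t => ?_⟩
  have hpow : 0 ≤ |t| ^ α := by positivity
  by_cases ht : |t| < δ
  · calc _ ≤ 1 * ‖|t| ^ α‖ := hball (by rwa [Real.dist_0_eq_abs])
      _ ≤ M * |t| ^ α := by
        rw [Real.norm_of_nonneg hpow]
        gcongr
        exact (le_max_left _ _).trans hM
  · calc _ ≤ ‖charFun ν t‖ + ‖(stableCharFun α c t : ℂ)‖ := norm_sub_le _ _
      _ ≤ 1 + 1 := add_le_add (norm_charFun_le_one t) (norm_stableCharFun_le_one hc α t)
      _ = 2 / δ ^ α * δ ^ α := by field_simp; norm_num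
      _ ≤ M * |t| ^ α := by
        gcongr
        · exact (le_max_right _ _).trans hM
        · exact not_lt.1 ht

end StableExpansion

section Truncation

variable {Ω : Type*} [MeasurableSpace Ω] {P : Measure Ω} {μ : Kernel Ω ℝ} {α c : ℝ}

/-- The event that `|φ(q) - exp (-c |q|^α)| ≤ M |q|^α` for all `q`, where `φ` is the characteristic
function of the random measure. Rational `q` suffice by continuity, and make the event visibly
measurable. -/
def truncSet (μ : Kernel Ω ℝ) (α c : ℝ) (M : ℕ) : Set Ω :=
  {ω | ∀ q : ℚ, ‖charFun (μ ω) (q : ℝ) - (stableCharFun α c q : ℂ)‖ ≤ M * |(q : ℝ)| ^ α}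

lemma measurableSet_truncSet (M : ℕ) : MeasurableSet (truncSet μ α c M) := by
  simp only [truncSet, Set.ofPred_forall]
  exact MeasurableSet.iInter fun q => measurableSet_le
    ((measurable_charFun_kernel q).sub_const _).norm measurable_const

lemma norm_charFun_sub_le_of_mem_truncSet [IsFiniteKernel μ] (hα : 0 < α) {M : ℕ} {ω : Ω}
    (hω : ω ∈ truncSet μ α c M) (t : ℝ) :
    ‖charFun (μ ω) t - (stableCharFun α c t : ℂ)‖ ≤ M * |t| ^ α :=
  Rat.denseRange_cast.induction_on (p := fun t : ℝ =>
    ‖charFun (μ ω) t - (stableCharFun α c t : ℂ)‖ ≤ M * |t| ^ α) t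
    (isClosed_le (continuous_charFun.sub
      (Complex.continuous_ofReal.comp (continuous_stableCharFun hα c))).norm
      (continuous_const.mul (continuous_abs_rpow hα))) hω

lemma monotone_truncSet : Monotone (truncSet μ α c) := by
  intro M N hMN ω hω q
  refine (hω q).trans ?_
  gcongr

lemma tendsto_measureReal_compl_truncSet [IsMarkovKernel μ] [IsFiniteMeasure P]
    (hα : 0 < α) (hc : 0 ≤ c) (hμS : ∀ᵐ ω ∂P, HasStableExpansion α c (μ ω)) :
    Tendsto (fun M => P.real (truncSet μ α c M)ᶜ) atTop (𝓝 0) := by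
  have hlim := tendsto_measure_iInter_atTop (μ := P) (s := fun M => (truncSet μ α c M)ᶜ)
    (fun M => (measurableSet_truncSet M).compl.nullMeasurableSet)
    (fun M N h => Set.compl_subset_compl.2 (monotone_truncSet h)) ⟨0, measure_ne_top _ _⟩
  have hnull : P (⋂ M, (truncSet μ α c M)ᶜ) = 0 := by
    refine measure_mono_null ?_ (ae_iff.1 hμS)
    intro ω hω h
    obtain ⟨M, hM⟩ := h.exists_norm_charFun_sub_le hα hc
    exact Set.mem_iInter.1 hω M fun q => hM q
  rw [hnull] at hlim
  simpa [Measure.real, Function.comp_def] using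
    (ENNReal.tendsto_toReal ENNReal.zero_ne_top).comp hlim

lemma setIntegral_truncSet_isLittleO [IsMarkovKernel μ] [IsFiniteMeasure P]
    (hα : 0 < α) (hμS : ∀ᵐ ω ∂P, HasStableExpansion α c (μ ω)) (M : ℕ) :
    (fun t : ℝ => ∫ ω in truncSet μ α c M, ‖charFun (μ ω) t - (stableCharFun α c t : ℂ)‖ ∂P)
      =o[𝓝 0] (fun t : ℝ => |t| ^ α) := by
  have hzero (t : ℝ) (ht : |t| ^ α = 0) :
      ∫ ω in truncSet μ α c M, ‖charFun (μ ω) t - (stableCharFun α c t : ℂ)‖ ∂P = 0 := by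
    have ht0 : t = 0 := abs_eq_zero.1 ((Real.rpow_eq_zero (abs_nonneg t) hα.ne').1 ht)
    simp [ht0, stableCharFun, Real.zero_rpow hα.ne']
  rw [isLittleO_iff_tendsto hzero]
  simp_rw [← integral_div]
  suffices h : Tendsto (fun t : ℝ => ∫ ω in truncSet μ α c M,
      ‖charFun (μ ω) t - (stableCharFun α c t : ℂ)‖ / |t| ^ α ∂P) (𝓝 0)
      (𝓝 (∫ _ in truncSet μ α c M, (0 : ℝ) ∂P)) by simpa only [integral_zero] using h
  refine tendsto_integral_filter_of_dominated_convergence (fun _ => (M : ℝ)) ?_ ?_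
    (integrable_const _) ?_
  · exact Eventually.of_forall fun t => (((measurable_charFun_kernel t).sub_const
      _).norm.div_const _).aestronglyMeasurable
  · refine Eventually.of_forall fun t => ?_
    filter_upwards [ae_restrict_mem (measurableSet_truncSet M)] with ω hω
    rw [Real.norm_of_nonneg (by positivity)]
    exact div_le_of_le_mul₀ (by positivity) (by positivity)
      (norm_charFun_sub_le_of_mem_truncSet hα hω t)
  · filter_upwards [ae_restrict_of_ae hμS] with ω hω
    exact (hω.charFun_sub_isLittleO hα).norm_left.tendsto_div_nhds_zero

end Truncation

section Telescoping

lemma norm_sub_prod_mul_le_sum_Ico {R : Type*} [SeminormedCommRing R] {M N : ℕ} (hMN : M ≤ N)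
    {I z : ℕ → R} {e : ℕ → ℝ} (hz : ∀ k, ‖z k‖ ≤ 1)
    (h : ∀ k, M ≤ k → ‖I (k + 1) - z k * I k‖ ≤ e k) :
    ‖I N - (∏ j ∈ Finset.Ico M N, z j) * I M‖ ≤ ∑ k ∈ Finset.Ico M N, e k := by
  induction N, hMN using Nat.le_induction with
  | base => simp
  | succ N hMN ih =>
    rw [Finset.prod_Ico_succ_top hMN, Finset.sum_Ico_succ_top hMN]
    calc ‖I (N + 1) - (∏ j ∈ Finset.Ico M N, z j) * z N * I M‖
        = ‖z N * (I N - (∏ j ∈ Finset.Ico M N, z j) * I M) + (I (N + 1) - z N * I N)‖ := by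
          congr 1; ring
      _ ≤ ‖z N * (I N - (∏ j ∈ Finset.Ico M N, z j) * I M)‖ + ‖I (N + 1) - z N * I N‖ :=
          norm_add_le _ _
      _ ≤ ‖I N - (∏ j ∈ Finset.Ico M N, z j) * I M‖ + e N := by
          refine add_le_add ((norm_mul_le _ _).trans ?_) (h N hMN)
          exact mul_le_of_le_one_left (norm_nonneg _) (hz N)
      _ ≤ _ := by gcongr

variable {Ω : Type*} [MeasurableSpace Ω] {P : Measure Ω} [IsProbabilityMeasure P]
  {X : ℕ → Ω → ℝ} {μ : Kernel Ω ℝ} {A : ℕ → Set Ω} {n : ℕ → ℕ} {t : ℕ → ℝ} {M N : ℕ}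

lemma integrable_expProd (hX : ∀ n, Measurable (X n)) (s : Finset ℕ) (n : ℕ → ℕ) (t : ℕ → ℝ) :
    Integrable (fun ω => expProd s t fun j => X (n j) ω) P :=
  Integrable.of_bound (measurable_expProd hX s n t).aestronglyMeasurable 1
    (ae_of_all _ fun _ => (norm_expProd ..).le)

lemma IsAlmostExchangeable.norm_setIntegral_succ_sub_le [IsMarkovKernel μ]
    (hn : IsAlmostExchangeable P X μ A n) (hX : ∀ n, Measurable (X n)) (ht : ∀ j, |t j| ≤ 1)
    {k : ℕ} (hMk : M ≤ k) (z : ℂ) :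
    ‖(∫ ω in A M, expProd (Finset.Ico M (k + 1)) t (fun j => X (n j) ω) ∂P)
      - z * ∫ ω in A M, expProd (Finset.Ico M k) t (fun j => X (n j) ω) ∂P‖
      ≤ (1 / 2) ^ k + ∫ ω in A M, ‖charFun (μ ω) (t k) - z‖ ∂P := by
  have hexp := (integrable_expProd (P := P) hX (Finset.Ico M k) n t).integrableOn (s := A M)
  have hexpφ : IntegrableOn (fun ω => expProd (Finset.Ico M k) t (fun j => X (n j) ω)
      * charFun (μ ω) (t k)) (A M) P :=
    hexp.mul_bdd (c := 1) (measurable_charFun_kernel (t k)).aestronglyMeasurable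
      (ae_of_all _ fun _ => norm_charFun_le_one (t k))
  refine (norm_sub_le_norm_sub_add_norm_sub _ _ _).trans (add_le_add (hn k M hMk t ht) ?_)
  calc _ = ‖∫ ω in A M, expProd (Finset.Ico M k) t (fun j => X (n j) ω)
        * (charFun (μ ω) (t k) - z) ∂P‖ := by
        rw [← integral_const_mul, ← integral_sub hexpφ (hexp.const_mul z)]
        congr! 3
        ring
    _ ≤ _ := (norm_integral_le_integral_norm _).trans_eq (by
        simp only [norm_mul, norm_expProd, one_mul])

lemma IsAlmostExchangeable.norm_setIntegral_sub_prod_mul_le [IsMarkovKernel μ]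
    (hn : IsAlmostExchangeable P X μ A n) (hX : ∀ n, Measurable (X n)) (ht : ∀ j, |t j| ≤ 1)
    (hMN : M ≤ N) {z : ℕ → ℂ} (hz : ∀ j, ‖z j‖ ≤ 1) :
    ‖(∫ ω in A M, expProd (Finset.Ico M N) t (fun j => X (n j) ω) ∂P)
      - (∏ j ∈ Finset.Ico M N, z j) * P.real (A M)‖
      ≤ 2 * (1 / 2) ^ M
        + ∑ k ∈ Finset.Ico M N, ∫ ω in A M, ‖charFun (μ ω) (t k) - z k‖ ∂P := by
  have hgeom : ∑ k ∈ Finset.Ico M N, (1 / 2 : ℝ) ^ k ≤ 2 * (1 / 2) ^ M :=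
    (geom_sum_Ico_le_of_lt_one (by norm_num) (by norm_num)).trans_eq (by ring)
  have h := norm_sub_prod_mul_le_sum_Ico hMN
    (I := fun k => ∫ ω in A M, expProd (Finset.Ico M k) t (fun j => X (n j) ω) ∂P)
    (e := fun k => (1 / 2) ^ k + ∫ ω in A M, ‖charFun (μ ω) (t k) - z k‖ ∂P) hz
    fun k hMk => hn.norm_setIntegral_succ_sub_le hX ht hMk (z k)
  have hstart : ∫ ω in A M, expProd (Finset.Ico M M) t (fun j => X (n j) ω) ∂P = P.real (A M) := by
    simp [expProd]
  rw [hstart, Finset.sum_add_distrib] at h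
  exact h.trans (by gcongr)

lemma norm_integral_expProd_range_sub_le (hX : ∀ n, Measurable (X n)) {B : Set Ω}
    (hB : MeasurableSet B) (n : ℕ → ℕ) (t : ℕ → ℝ) (hMN : M ≤ N) :
    ‖(∫ ω, expProd (Finset.range N) t (fun j => X (n j) ω) ∂P)
      - ∫ ω in B, expProd (Finset.Ico M N) t (fun j => X (n j) ω) ∂P‖
      ≤ (∫ ω, ‖expProd (Finset.range M) t (fun j => X (n j) ω) - 1‖ ∂P) + P.real Bᶜ := by
  have hint (s : Finset ℕ) := integrable_expProd (P := P) hX s n t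
  have hsplit (ω : Ω) : expProd (Finset.range N) t (fun j => X (n j) ω)
      - expProd (Finset.Ico M N) t (fun j => X (n j) ω)
      = (expProd (Finset.range M) t (fun j => X (n j) ω) - 1)
        * expProd (Finset.Ico M N) t (fun j => X (n j) ω) := by
    rw [expProd, ← Finset.prod_range_mul_prod_Ico _ hMN, expProd, expProd]
    ring
  refine (norm_sub_le_norm_sub_add_norm_sub _
    (∫ ω, expProd (Finset.Ico M N) t (fun j => X (n j) ω) ∂P) _).trans (add_le_add ?_ ?_)
  · rw [← integral_sub (hint _) (hint _)]
    refine (norm_integral_le_integral_norm _).trans_eq ?_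
    simp only [hsplit, norm_mul, norm_expProd, mul_one]
  · rw [← integral_add_compl hB (hint _), add_sub_cancel_left]
    simpa using norm_setIntegral_le_of_norm_le_const (measure_lt_top P Bᶜ)
      fun ω _ => (norm_expProd (Finset.Ico M N) t fun j => X (n j) ω).le

lemma IsAlmostExchangeable.norm_integral_expProd_range_sub_prod_le [IsMarkovKernel μ]
    (hn : IsAlmostExchangeable P X μ A n) (hX : ∀ n, Measurable (X n))
    (hA : MeasurableSet (A M)) (ht : ∀ j, |t j| ≤ 1) (hMN : M ≤ N) {z : ℕ → ℂ}
    (hz : ∀ j, ‖z j‖ ≤ 1) :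
    ‖(∫ ω, expProd (Finset.range N) t (fun j => X (n j) ω) ∂P) - ∏ j ∈ Finset.Ico M N, z j‖
      ≤ (2 * P.real (A M)ᶜ + 2 * (1 / 2) ^ M)
        + ((∫ ω, ‖expProd (Finset.range M) t (fun j => X (n j) ω) - 1‖ ∂P)
          + ∑ k ∈ Finset.Ico M N, ∫ ω in A M, ‖charFun (μ ω) (t k) - z k‖ ∂P) := by
  have hprod : ‖(∏ j ∈ Finset.Ico M N, z j) * P.real (A M) - ∏ j ∈ Finset.Ico M N, z j‖
      ≤ P.real (A M)ᶜ := by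
    have hfactor : (∏ j ∈ Finset.Ico M N, z j) * P.real (A M) - ∏ j ∈ Finset.Ico M N, z j
        = (∏ j ∈ Finset.Ico M N, z j) * (-P.real (A M)ᶜ : ℝ) := by
      rw [probReal_compl_eq_one_sub hA]
      push_cast
      ring
    rw [hfactor, norm_mul, Complex.norm_real, norm_neg, Real.norm_of_nonneg measureReal_nonneg,
      norm_prod]
    exact mul_le_of_le_one_left measureReal_nonneg
      (Finset.prod_le_one (fun _ _ => norm_nonneg _) fun j _ => hz j)
  have hhead := norm_integral_expProd_range_sub_le (P := P) hX hA n t hMN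
  have htail := hn.norm_setIntegral_sub_prod_mul_le hX ht hMN hz
  have htriangle := dist_triangle4 (∫ ω, expProd (Finset.range N) t (fun j => X (n j) ω) ∂P)
    (∫ ω in A M, expProd (Finset.Ico M N) t (fun j => X (n j) ω) ∂P)
    ((∏ j ∈ Finset.Ico M N, z j) * P.real (A M)) (∏ j ∈ Finset.Ico M N, z j)
  simp only [dist_eq_norm] at htriangle
  linarith

end Telescoping

section TriangularArrays

variable {α c B : ℝ} {t : ℕ → ℕ → ℝ}

lemma sum_Ico_isLittleO_sum_rpow {E : Type*} [SeminormedAddCommGroup E] {ρ : ℝ → E}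
    (hρ : ρ =o[𝓝 0] fun t : ℝ => |t| ^ α) (ht : TendstoUniformly t 0 atTop) (M : ℕ) :
    (fun N => ∑ j ∈ Finset.Ico M N, ρ (t N j)) =o[atTop]
      fun N => ∑ j ∈ Finset.range N, |t N j| ^ α := by
  refine isLittleO_iff.2 fun ε hε => ?_
  obtain ⟨δ, hδ, hball⟩ := Metric.eventually_nhds_iff.1 (hρ.def hε)
  filter_upwards [Metric.tendstoUniformly_iff.1 ht δ hδ] with N hN
  calc ‖∑ j ∈ Finset.Ico M N, ρ (t N j)‖ ≤ ∑ j ∈ Finset.Ico M N, ‖ρ (t N j)‖ := norm_sum_le _ _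
    _ ≤ ∑ j ∈ Finset.Ico M N, ε * ‖|t N j| ^ α‖ := by
        refine Finset.sum_le_sum fun j _ => hball ?_
        rw [dist_comm]
        exact hN j
    _ ≤ ∑ j ∈ Finset.range N, ε * ‖|t N j| ^ α‖ := by
        rw [Finset.range_eq_Ico]
        exact Finset.sum_le_sum_of_subset_of_nonneg
          (Finset.Ico_subset_Ico_left (Nat.zero_le M)) fun _ _ _ => by positivity
    _ = ε * ‖∑ j ∈ Finset.range N, |t N j| ^ α‖ := by
        rw [← Finset.mul_sum, Real.norm_of_nonneg (Finset.sum_nonneg fun _ _ => by positivity)]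
        simp only [Real.norm_of_nonneg (Real.rpow_nonneg (abs_nonneg _) α)]

lemma tendsto_prod_Ico_stableCharFun (hα : 0 < α) (c : ℝ) (ht : TendstoUniformly t 0 atTop)
    (hB : Tendsto (fun N => ∑ j ∈ Finset.range N, |t N j| ^ α) atTop (𝓝 B)) (M : ℕ) :
    Tendsto (fun N => ∏ j ∈ Finset.Ico M N, (stableCharFun α c (t N j) : ℂ)) atTop
      (𝓝 (Real.exp (-c * B) : ℝ)) := by
  have hhead : Tendsto (fun N => ∑ j ∈ Finset.range M, |t N j| ^ α) atTop (𝓝 0) := by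
    have h := tendsto_finsetSum (Finset.range M) fun j _ =>
      ((continuous_abs_rpow hα).tendsto 0).comp (ht.tendsto_at j)
    simpa [Real.zero_rpow hα.ne', Function.comp_def] using h
  have hlim := (Complex.continuous_ofReal.comp Real.continuous_exp).tendsto _ |>.comp
    ((hB.sub hhead).const_mul (-c))
  rw [sub_zero] at hlim
  refine hlim.congr' ?_
  filter_upwards [eventually_ge_atTop M] with N hMN
  simp only [Function.comp_apply, stableCharFun]
  rw [← Finset.sum_Ico_eq_sub _ hMN, Finset.mul_sum, Real.exp_sum, Complex.ofReal_prod]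

variable {Ω : Type*} [MeasurableSpace Ω] {P : Measure Ω} [IsProbabilityMeasure P]
  {X : ℕ → Ω → ℝ} {μ : Kernel Ω ℝ}

lemma tendsto_integral_norm_expProd_sub_one (hX : ∀ n, Measurable (X n)) (s : Finset ℕ)
    (n : ℕ → ℕ) (ht : Tendsto t atTop (𝓝 0)) :
    Tendsto (fun N => ∫ ω, ‖expProd s (t N) (fun j => X (n j) ω) - 1‖ ∂P) atTop (𝓝 0) := by
  rw [← integral_zero Ω ℝ (μ := P)]
  refine tendsto_integral_of_dominated_convergence (fun _ => 2) (fun N => ?_)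
    (integrable_const _) (fun N => ae_of_all _ fun ω => ?_) (ae_of_all _ fun ω => ?_)
  · exact ((measurable_expProd hX s n (t N)).sub_const 1).norm.aestronglyMeasurable
  · rw [norm_norm]
    refine (norm_sub_le _ _).trans_eq ?_
    rw [norm_expProd, norm_one]
    norm_num
  · have h := ((continuous_expProd s).tendsto (0, fun j => X (n j) ω)).comp
      (ht.prodMk_nhds tendsto_const_nhds)
    simpa [expProd] using (h.sub_const 1).norm

lemma IsAlmostExchangeable.tendsto_integral_expProd [IsMarkovKernel μ] {n : ℕ → ℕ}
    (hn : IsAlmostExchangeable P X μ (truncSet μ α c) n) (hX : ∀ n, Measurable (X n))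
    (hα : 0 < α) (hc : 0 ≤ c) (hμS : ∀ᵐ ω ∂P, HasStableExpansion α c (μ ω))
    (ht : TendstoUniformly t 0 atTop)
    (hB : Tendsto (fun N => ∑ j ∈ Finset.range N, |t N j| ^ α) atTop (𝓝 B)) :
    Tendsto (fun N => ∫ ω, expProd (Finset.range N) (t N) (fun j => X (n j) ω) ∂P) atTop
      (𝓝 (Real.exp (-c * B) : ℝ)) := by
  rw [Metric.tendsto_nhds]
  intro ε hε
  have htrunc : Tendsto (fun M => 2 * P.real (truncSet μ α c M)ᶜ + 2 * (1 / 2 : ℝ) ^ M) atTop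
      (𝓝 0) := by
    simpa using ((tendsto_measureReal_compl_truncSet hα hc hμS).const_mul 2).add
      ((tendsto_pow_atTop_nhds_zero_of_lt_one (r := (1 / 2 : ℝ)) (by norm_num)
        (by norm_num)).const_mul 2)
  obtain ⟨M, hM⟩ := (htrunc.eventually_lt_const (half_pos hε)).exists
  have hhead := tendsto_integral_norm_expProd_sub_one (P := P) hX (Finset.range M) n
    (tendsto_pi_nhds.2 fun j => ht.tendsto_at j)
  have htail := (isLittleO_one_iff ℝ).1 ((sum_Ico_isLittleO_sum_rpow
    (setIntegral_truncSet_isLittleO hα hμS M) ht M).trans_isBigO (hB.isBigO_one ℝ))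
  have hprod := tendsto_iff_dist_tendsto_zero.1 (tendsto_prod_Ico_stableCharFun hα c ht hB M)
  have hrest := (hhead.add htail).add hprod
  rw [add_zero, add_zero] at hrest
  filter_upwards [hrest.eventually_lt_const (half_pos hε), eventually_ge_atTop M,
    Metric.tendstoUniformly_iff.1 ht 1 one_pos] with N hN hMN htN
  have hdist := hn.norm_integral_expProd_range_sub_prod_le hX (measurableSet_truncSet M)
    (fun j => by simpa using (htN j).le) hMN fun j => norm_stableCharFun_le_one hc α (t N j)
  rw [← dist_eq_norm] at hdist
  linarith [dist_triangle (∫ ω, expProd (Finset.range N) (t N) (fun j => X (n j) ω) ∂P)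
    (∏ j ∈ Finset.Ico M N, (stableCharFun α c (t N j) : ℂ)) (Real.exp (-c * B) : ℝ)]

end TriangularArrays

section LevyContinuity

variable {E : Type*} [NormedAddCommGroup E] [InnerProductSpace ℝ E] [FiniteDimensional ℝ E]
  [MeasurableSpace E] [BorelSpace E]

lemma exists_probabilityMeasure_of_tendsto_charFun {ν : ℕ → Measure E}
    [∀ i, IsProbabilityMeasure (ν i)] {f : E → ℂ} (hf : ContinuousAt f 0)
    (h : ∀ t, Tendsto (fun n => charFun (ν n) t) atTop (𝓝 (f t))) :
    ∃ G : ProbabilityMeasure E, ∀ t, charFun (G : Measure E) t = f t := by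
  have htight := isTightMeasureSet_of_tendsto_charFun hf h
  let ρ : ℕ → ProbabilityMeasure E := fun n => ⟨ν n, inferInstance⟩
  have hcomp : IsCompact (closure (Set.range ρ)) := by
    refine isCompact_closure_of_isTightMeasureSet (htight.subset ?_)
    rintro _ ⟨_, ⟨n, rfl⟩, rfl⟩
    exact ⟨n, rfl⟩
  obtain ⟨G, -, φ, hφ, hG⟩ := hcomp.tendsto_subseq fun n => subset_closure ⟨n, rfl⟩
  refine ⟨G, fun t => ?_⟩
  exact tendsto_nhds_unique (ProbabilityMeasure.tendsto_iff_tendsto_charFun.1 hG t)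
    ((h t).comp hφ.tendsto_atTop)

lemma tendstoInDistribution_id_of_tendsto_charFun {Ω : Type*} [MeasurableSpace Ω]
    {P : Measure Ω} [IsProbabilityMeasure P] {Y : ℕ → Ω → E}
    (hY : ∀ N, AEMeasurable (Y N) P) {G : ProbabilityMeasure E}
    (h : ∀ u, Tendsto (fun N => charFun (P.map (Y N)) u) atTop
      (𝓝 (charFun (G : Measure E) u))) :
    TendstoInDistribution Y atTop (id : E → E) (fun _ => P) (G : Measure E) where
  forall_aemeasurable := hY
  aemeasurable_limit := aemeasurable_id
  tendsto := ProbabilityMeasure.tendsto_iff_tendsto_charFun.2 fun u => by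
    simpa only [ProbabilityMeasure.coe_mk, Measure.map_id] using h u

end LevyContinuity

section Weights

variable {α : ℝ} {a : ℕ → ℝ}

/-- The coefficient of the `j`-th term in the `N`-th normalized weighted sum; it is extended by `0`
to `j ≥ N`, so that smallness of the coefficients can be required uniformly in `j`. -/
def normalizedWeight (α : ℝ) (a : ℕ → ℝ) (N j : ℕ) : ℝ :=
  if j < N then a j / weightNorm α a N else 0

lemma abs_le_weightMax (a : ℕ → ℝ) {j N : ℕ} (hj : j < N) : |a j| ≤ weightMax a N := by
  have h := Finset.le_sup (f := fun k => ‖a k‖₊) (Finset.mem_range.2 hj)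
  exact_mod_cast h

lemma weightNorm_nonneg (α : ℝ) (a : ℕ → ℝ) (N : ℕ) : 0 ≤ weightNorm α a N := by
  unfold weightNorm
  positivity

lemma weightNorm_rpow (hα : α ≠ 0) (a : ℕ → ℝ) (N : ℕ) :
    weightNorm α a N ^ α = ∑ k ∈ Finset.range N, |a k| ^ α := by
  rw [weightNorm, ← Real.rpow_mul (by positivity), one_div_mul_cancel hα, Real.rpow_one]

lemma eventually_weightNorm_pos (α : ℝ) (ha : ∃ k, a k ≠ 0) :
    ∀ᶠ N in atTop, 0 < weightNorm α a N := by
  obtain ⟨k, hk⟩ := ha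
  filter_upwards [eventually_gt_atTop k] with N hN
  refine Real.rpow_pos_of_pos (Finset.sum_pos' (fun _ _ => by positivity)
    ⟨k, Finset.mem_range.2 hN, by positivity⟩) _

lemma tendstoUniformly_normalizedWeight (hmax : weightMax a =o[atTop] weightNorm α a) :
    TendstoUniformly (normalizedWeight α a) 0 atTop := by
  rw [Metric.tendstoUniformly_iff]
  intro ε hε
  filter_upwards [hmax.tendsto_div_nhds_zero.eventually_lt_const hε] with N hN j
  rw [Pi.zero_apply, dist_zero_left, normalizedWeight]
  split_ifs with hj
  · rw [norm_div, Real.norm_eq_abs, Real.norm_of_nonneg (weightNorm_nonneg α a N)]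
    refine lt_of_le_of_lt ?_ hN
    have := weightNorm_nonneg α a N
    gcongr
    exact abs_le_weightMax a hj
  · rwa [norm_zero]

lemma eventually_sum_abs_normalizedWeight_rpow (hα : α ≠ 0) (ha : ∃ k, a k ≠ 0) :
    ∀ᶠ N in atTop, ∑ j ∈ Finset.range N, |normalizedWeight α a N j| ^ α = 1 := by
  filter_upwards [eventually_weightNorm_pos α ha] with N hpos
  have hterm (j : ℕ) (hj : j ∈ Finset.range N) :
      |normalizedWeight α a N j| ^ α = |a j| ^ α / weightNorm α a N ^ α := by
    rw [normalizedWeight, if_pos (Finset.mem_range.1 hj), abs_div, abs_of_pos hpos,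
      Real.div_rpow (abs_nonneg _) hpos.le]
  rw [Finset.sum_congr rfl hterm, ← Finset.sum_div, ← weightNorm_rpow hα,
    div_self (Real.rpow_pos_of_pos hpos α).ne']

lemma weightMax_const_one_isLittleO (hα : 0 < α) :
    weightMax (fun _ => 1) =o[atTop] weightNorm α (fun _ => 1) := by
  have hmax : weightMax (fun _ => 1) =O[atTop] fun _ : ℕ => (1 : ℝ) := by
    refine IsBigO.of_bound 1 (Eventually.of_forall fun N => ?_)
    have hle : (Finset.range N).sup (fun _ => ‖(1 : ℝ)‖₊) ≤ 1 := Finset.sup_le fun _ _ => by simp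
    rw [norm_one, mul_one, weightMax, NNReal.norm_eq]
    exact_mod_cast hle
  have hnorm : Tendsto (fun N : ℕ => (N : ℝ) ^ (1 / α)) atTop atTop :=
    (tendsto_rpow_atTop (by positivity)).comp tendsto_natCast_atTop_atTop
  refine hmax.trans_isLittleO ((isLittleO_const_left).2 (Or.inr ?_))
  exact tendsto_norm_atTop_atTop.comp (hnorm.congr fun N => by simp [weightNorm])

end Weights

section WeightedSums

variable {Ω : Type*} [MeasurableSpace Ω] {P : Measure Ω} {X : ℕ → Ω → ℝ} {μ : Kernel Ω ℝ}
  {α c : ℝ} {a : ℕ → ℝ} {n : ℕ → ℕ}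

lemma charFun_map_sum_eq_integral_expProd (hX : ∀ n, Measurable (X n)) (n : ℕ → ℕ) (s : Finset ℕ)
    (b : ℕ → ℝ) (u : ℝ) :
    charFun (P.map fun ω => ∑ j ∈ s, b j * X (n j) ω) u
      = ∫ ω, expProd s (fun j => u * b j) (fun j => X (n j) ω) ∂P := by
  rw [charFun_apply_real, integral_map (by fun_prop) (by fun_prop)]
  congr! 2 with ω
  rw [expProd, ← Complex.exp_sum, ← Finset.sum_mul]
  push_cast
  rw [Finset.mul_sum]
  simp only [mul_assoc]

lemma weightNorm_inv_mul_sum (α : ℝ) (a x : ℕ → ℝ) (N : ℕ) :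
    (weightNorm α a N)⁻¹ * ∑ k ∈ Finset.range N, a k * x k
      = ∑ k ∈ Finset.range N, normalizedWeight α a N k * x k := by
  rw [Finset.mul_sum]
  refine Finset.sum_congr rfl fun k hk => ?_
  rw [normalizedWeight, if_pos (Finset.mem_range.1 hk)]
  ring

lemma IsAlmostExchangeable.tendsto_charFun_weightedSum [IsProbabilityMeasure P] [IsMarkovKernel μ]
    (hn : IsAlmostExchangeable P X μ (truncSet μ α c) n) (hX : ∀ n, Measurable (X n))
    (hα : 0 < α) (hc : 0 ≤ c) (hμS : ∀ᵐ ω ∂P, HasStableExpansion α c (μ ω)) (ha : ∃ k, a k ≠ 0)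
    (hmax : weightMax a =o[atTop] weightNorm α a) (u : ℝ) :
    Tendsto (fun N => charFun (P.map fun ω => (weightNorm α a N)⁻¹ *
      ∑ k ∈ Finset.range N, a k * X (n k) ω) u) atTop (𝓝 (stableCharFun α c u : ℂ)) := by
  simp_rw [weightNorm_inv_mul_sum, charFun_map_sum_eq_integral_expProd hX]
  refine hn.tendsto_integral_expProd hX hα hc hμS ?_ ?_
  · have h := (uniformContinuous_const_smul u).comp_tendstoUniformly
      (tendstoUniformly_normalizedWeight hmax)
    simpa [Function.comp_def, Pi.zero_def] using h
  · refine tendsto_nhds_of_eventually_eq ?_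
    filter_upwards [eventually_sum_abs_normalizedWeight_rpow hα.ne' ha] with N hN
    simp_rw [abs_mul, Real.mul_rpow (abs_nonneg _) (abs_nonneg _)]
    rw [← Finset.mul_sum, hN, mul_one]

end WeightedSums

end SubseqStable

end

theorem theorem2_general {Ω : Type*} [MeasurableSpace Ω] (P : Measure Ω) [IsProbabilityMeasure P]
    (α c : ℝ) (hα : 0 < α) (hc : 0 ≤ c) (X : ℕ → Ω → ℝ) (hX : ∀ n, Measurable (X n))
    (μ : Kernel Ω ℝ) (hμ : SubseqStable.IsLimitRandomMeasure P X μ)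
    (hμS : ∀ᵐ ω ∂P, SubseqStable.HasStableExpansion α c (μ ω)) :
    ∃ G : ProbabilityMeasure ℝ,
      (∀ t : ℝ, charFun (G : Measure ℝ) t = ((Real.exp (-c * |t| ^ α) : ℝ) : ℂ)) ∧
      ∃ n : ℕ → ℕ, StrictMono n ∧
        ∀ a : ℕ → ℝ, (∃ k, a k ≠ 0) →
          SubseqStable.weightMax a =o[atTop] SubseqStable.weightNorm α a →
          TendstoInDistribution
            (fun (N : ℕ) (ω : Ω) => (SubseqStable.weightNorm α a N)⁻¹ *
              ∑ k ∈ Finset.range N, a k * X (n k) ω)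
            atTop (id : ℝ → ℝ) (fun _ => P) (G : Measure ℝ) := by
  have := hμ.1
  obtain ⟨n, hmono, hn⟩ := hμ.exists_isAlmostExchangeable hX
    (A := SubseqStable.truncSet μ α c) SubseqStable.measurableSet_truncSet
  have hmeas (a : ℕ → ℝ) (N : ℕ) : AEMeasurable (fun ω => (SubseqStable.weightNorm α a N)⁻¹ *
      ∑ k ∈ Finset.range N, a k * X (n k) ω) P := by fun_prop
  have (N : ℕ) := Measure.isProbabilityMeasure_map (hmeas (fun _ => 1) N)
  obtain ⟨G, hG⟩ := SubseqStable.exists_probabilityMeasure_of_tendsto_charFun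
    (Complex.continuous_ofReal.comp (SubseqStable.continuous_stableCharFun hα c)).continuousAt
    (hn.tendsto_charFun_weightedSum hX hα hc hμS (a := fun _ => 1) ⟨0, one_ne_zero⟩
      (SubseqStable.weightMax_const_one_isLittleO hα))
  refine ⟨G, hG, n, hmono, fun a ha hmax => ?_⟩
  refine SubseqStable.tendstoInDistribution_id_of_tendsto_charFun (hmeas a) fun u => ?_
  rw [hG u]
  exact hn.tendsto_charFun_weightedSum hX hα hc hμS ha hmax u

theorem theorem2 {Ω : Type*} [MeasurableSpace Ω] (P : Measure Ω) [IsProbabilityMeasure P]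
    (α c : ℝ) (hα0 : 0 < α) (hα2 : α < 2) (hc : 0 < c)
    (X : ℕ → Ω → ℝ) (hX : ∀ n, Measurable (X n))
    (hdet : SubseqStable.IsDetermining P X)
    (μ : Kernel Ω ℝ) (hμ : SubseqStable.IsLimitRandomMeasure P X μ)
    (hμS : ∀ᵐ ω ∂P, μ ω ∈ SubseqStable.stableClass α c) :
    ∃ G : ProbabilityMeasure ℝ,
      (∀ t : ℝ, charFun (G : Measure ℝ) t = ((Real.exp (-c * |t| ^ α) : ℝ) : ℂ)) ∧
      ∃ n : ℕ → ℕ, StrictMono n ∧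
        ∀ a : ℕ → ℝ, (∃ k, a k ≠ 0) →
          SubseqStable.weightMax a =o[atTop] SubseqStable.weightNorm α a →
          TendstoInDistribution
            (fun (N : ℕ) (ω : Ω) => (SubseqStable.weightNorm α a N)⁻¹ *
              ∑ k ∈ Finset.range N, a k * X (n k) ω)
            atTop (id : ℝ → ℝ) (fun _ => P) (G : Measure ℝ) :=
  theorem2_general P α c hα0 hc.le X hX μ hμ (hμS.mono fun _ h => h.2.2)
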